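/- For a finite group $G$ and a finite-dimensional complex representation $V$ of $G$, let $\beta_{sep}(G,V)$ be the minimal positive integer $d$ such that for any $v,w\in V$ with different $G$-orbits there is a homogeneous $G$-invariant polynomial function $f\colon V\to\mathbb{C}$ of degree at most $d$ with $f(v)\neq f(w)$. The separating Noether number of $G$ is $\beta_{sep}(G):=\sup_V \beta_{sep}(G,V)$, where $V$ ranges over all finite-dimensional complex representations of $G$. **Theorem.** Let $n\ge 2$ and $r\ge 1$ be integers, let $C_n^r$ be the direct sum of $r$ copies of the cyclic group $C_n$ of order $n$, and let $p$ be the smallest prime divisor of $n$. Then $$\beta_{sep}(C_n^r)=\begin{cases} ns, & \text{if } r=2s-1 \text{ is odd},\\ ns+\dfrac{n}{p}, & \text{if } r=2s \text{ is even}.\end{cases}$$ -/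

import Mathlib

/-- `f : V → ℂ` is a homogeneous polynomial function of degree `k` on the complex vector space `V`:
it is a homogeneous polynomial expression of degree `k` in linear functionals on `V`.
(For finite-dimensional `V` this is the same as being given by a homogeneous polynomial
of degree `k` in the coordinates with respect to a basis.) -/
def IsHomogeneousPolynomialFunction {V : Type*} [AddCommGroup V] [Module ℂ V]
    (k : ℕ) (f : V → ℂ) : Prop :=
  ∃ P : MvPolynomial (Module.Dual ℂ V) ℂ, P.IsHomogeneous k ∧
    ∀ v : V, f v = MvPolynomial.eval (fun φ : Module.Dual ℂ V => φ v) P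

/-- Any two vectors of `V` with different `G`-orbits are separated by a homogeneous
`G`-invariant polynomial function of degree at most `d`. -/
def SeparatesOrbitsInDegree {G : Type*} [Group G] {V : Type*} [AddCommGroup V] [Module ℂ V]
    (ρ : Representation ℂ G V) (d : ℕ) : Prop :=
  ∀ v w : V, (∀ g : G, ρ g v ≠ w) →
    ∃ f : V → ℂ, (∃ k ≤ d, IsHomogeneousPolynomialFunction k f) ∧
      (∀ (g : G) (x : V), f (ρ g x) = f x) ∧ f v ≠ f w

/-- `β_sep(G, V)`: the minimal positive integer `d` such that vectors with different orbits are
separated by homogeneous invariants of degree at most `d` (it is `⊤` if there is no such `d`). -/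
noncomputable def sepNoetherNumberOfRep {G : Type*} [Group G] {V : Type*} [AddCommGroup V]
    [Module ℂ V] (ρ : Representation ℂ G V) : ℕ∞ :=
  ⨅ (d : ℕ) (_ : 0 < d ∧ SeparatesOrbitsInDegree ρ d), (d : ℕ∞)

/-- The separating Noether number `β_sep(G)`: the supremum of `β_sep(G, V)` over all
finite-dimensional complex representations `V` of `G`. Every such representation is isomorphic
to one on `ℂ ^ m`, so nothing is lost by letting `V` range over `Type`. -/
noncomputable def sepNoetherNumber (G : Type*) [Group G] : ℕ∞ :=
  ⨆ (V : Type) (_ : AddCommGroup V) (_ : Module ℂ V) (_ : FiniteDimensional ℂ V)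
    (ρ : Representation ℂ G V), sepNoetherNumberOfRep ρ

/-! Upper bound: suppose no invariant of degree at most `d` separates `v` from `w`. Take
eigenfunctionals nonzero at `v`, and let `K` be the lattice of multiplicative relations among their
characters. Nonnegative vectors in `K` with sum at most `d` are invariant monomials, so they are
also relations among the ratios `φ w / φ v`. If such vectors generate `K`, the ratios define a
character on the span of the characters; by duality it is evaluation at some `g`, and `g` moves `v`
to `w`. A Helly-type reduction leaves vectors of `K` with at most `r + 1` nonzero entries, for which
reduction mod `n` and a sign change suffice. Lower bound: `r + 1` characters of `C_n^r` with one
suitable relation force every separating monomial to have large degree. -/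

/-! ### Generating relation lattices by short vectors -/

/-- The subgroup of a group `K` of integer vectors generated by the elements of `K` that have
nonnegative entries with sum at most `d`. -/
noncomputable def shortSubgroup {I : Type*} (K : AddSubgroup (I →₀ ℤ)) (d : ℕ) : AddSubgroup (I →₀ ℤ) :=
  AddSubgroup.closure {x | x ∈ K ∧ (∀ i, 0 ≤ x i) ∧ ∑ i ∈ x.support, x i ≤ d}

/-- The vector of least nonnegative residues modulo `n`. -/
noncomputable def residues {I : Type*} (n : ℕ) (x : I →₀ ℤ) : I →₀ ℤ :=
  x.mapRange (· % (n : ℤ)) (Int.zero_emod _)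

/-- The sum of the least nonnegative residues modulo `n` of the entries of `x`. -/
noncomputable def residueSum {I : Type*} (n : ℕ) (x : I →₀ ℤ) : ℤ :=
  ∑ i ∈ x.support, x i % (n : ℤ)

section

variable {I : Type*} {K : AddSubgroup (I →₀ ℤ)} {n d : ℕ}

theorem nsmul_mem_shortSubgroup (hK : ∀ i, Finsupp.single i (n : ℤ) ∈ K) (hd : n ≤ d)
    (x : I →₀ ℤ) : (n : ℤ) • x ∈ shortSubgroup K d := by
  classical
  induction x using Finsupp.induction_linear with
  | zero => simp
  | add x y hx hy => rw [smul_add]; exact add_mem hx hy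
  | single i a =>
    have h : (n : ℤ) • Finsupp.single i a = a • Finsupp.single i (n : ℤ) := by
      simp [mul_comm]
    rw [h]
    have hmem : Finsupp.single i (n : ℤ) ∈ shortSubgroup K d := by
      refine AddSubgroup.subset_closure ⟨hK i, ?_, ?_⟩
      · exact Finsupp.single_nonneg.2 (Int.natCast_nonneg n)
      · refine le_trans (Finset.sum_le_sum_of_subset_of_nonneg Finsupp.support_single_subset
          fun j _ _ => Finsupp.single_nonneg.2 (Int.natCast_nonneg n) j) ?_
        simpa using hd
    exact zsmul_mem hmem a

theorem mem_shortSubgroup_of_residueSum_le (hn : 0 < n)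
    (hK : ∀ i, Finsupp.single i (n : ℤ) ∈ K) (hd : n ≤ d) {x : I →₀ ℤ} (hx : x ∈ K)
    (hs : residueSum n x ≤ d) : x ∈ shortSubgroup K d := by
  have hn' : (n : ℤ) ≠ 0 := by exact_mod_cast hn.ne'
  have hdec : x = residues n x + (n : ℤ) • x.mapRange (· / (n : ℤ)) (Int.zero_ediv _) := by
    ext i
    simp [residues, Int.emod_add_mul_ediv]
  have hmul := nsmul_mem_shortSubgroup hK hd (x.mapRange (· / (n : ℤ)) (Int.zero_ediv _))
  have hle : shortSubgroup K d ≤ K := (AddSubgroup.closure_le K).2 fun y hy => hy.1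
  rw [hdec]
  refine add_mem (AddSubgroup.subset_closure ⟨?_, fun i => ?_, ?_⟩) hmul
  · rw [← sub_eq_of_eq_add hdec]
    exact sub_mem hx (hle hmul)
  · simpa [residues] using Int.emod_nonneg (x i) hn'
  · refine le_trans (Finset.sum_le_sum_of_subset_of_nonneg Finsupp.support_mapRange ?_) hs
    intro i _ _
    simpa [residues] using Int.emod_nonneg (x i) hn'

/-- The residues of `a` and `-a` add up to `0` or `n`, so one of `x`, `-x` has residue sum at most
half the bound. -/
theorem residueSum_add_residueSum_neg_le (hn : 0 < n) (x : I →₀ ℤ) :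
    residueSum n x + residueSum n (-x) ≤ n * x.support.card := by
  rw [residueSum, residueSum, Finsupp.support_neg, ← Finset.sum_add_distrib, mul_comm,
    ← nsmul_eq_mul]
  refine Finset.sum_le_card_nsmul _ _ _ fun i _ => ?_
  have hn' : (0 : ℤ) < n := by exact_mod_cast hn
  rw [Finsupp.neg_apply]
  have h1 := Int.emod_lt_of_pos (x i) hn'
  have h2 := Int.emod_lt_of_pos (-x i) hn'
  have h3 : (x i % n + -x i % n) % (n : ℤ) = 0 := by simp
  obtain ⟨c, hc⟩ := Int.dvd_of_emod_eq_zero h3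
  have : c < 2 := by by_contra! h; nlinarith
  nlinarith

theorem residueSum_modEq (x : I →₀ ℤ) :
    residueSum n x ≡ ∑ i ∈ x.support, x i [ZMOD n] := by
  simpa [residueSum, Int.ModEq] using (Finset.sum_int_mod x.support (n : ℤ) x).symm

theorem mem_shortSubgroup_of_card_support_le_even (hn : 0 < n)
    (hK : ∀ i, Finsupp.single i (n : ℤ) ∈ K) {s : ℕ} (hs : 0 < s) {x : I →₀ ℤ} (hx : x ∈ K)
    (hcard : x.support.card ≤ 2 * s) : x ∈ shortSubgroup K (n * s) := by
  have hd : n ≤ n * s := Nat.le_mul_of_pos_right n hs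
  have hsum := residueSum_add_residueSum_neg_le hn x
  have hle : (n : ℤ) * x.support.card ≤ n * (2 * s) := by
    exact_mod_cast Nat.mul_le_mul_left n hcard
  rcases le_or_gt (residueSum n x) ((n * s : ℕ) : ℤ) with h | h
  · exact mem_shortSubgroup_of_residueSum_le hn hK hd hx h
  · rw [← neg_mem_iff]
    refine mem_shortSubgroup_of_residueSum_le hn hK hd (neg_mem hx) ?_
    push_cast at h ⊢
    linarith

/-- Every residue is a unit times a divisor of `n`. Since `t` is invertible mod `n`, `x` can be
replaced by `t • x` modulo multiples of `n`. -/
theorem exists_coprime_mul_modEq_divisor (n : ℕ) (a : ℤ) :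
    ∃ g : ℕ, g ∣ n ∧ ∃ t u c : ℤ, t * u = 1 + n * c ∧ t * a ≡ g [ZMOD n] := by
  obtain ⟨g, hg, u, hu, h⟩ := ZMod.eq_unit_mul_divisor (a : ZMod n)
  obtain ⟨v, rfl⟩ := hu
  obtain ⟨t, ht⟩ := ZMod.intCast_surjective ((v⁻¹ : (ZMod n)ˣ) : ZMod n)
  obtain ⟨w, hw⟩ := ZMod.intCast_surjective (v : ZMod n)
  have h1 : ((1 : ℤ) : ZMod n) = ((t * w : ℤ) : ZMod n) := by
    push_cast; rw [ht, hw]; simp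
  obtain ⟨c, hc⟩ := ((ZMod.intCast_eq_intCast_iff _ _ _).1 h1).dvd
  refine ⟨g, hg, t, w, c, by linarith, ?_⟩
  rw [← ZMod.intCast_eq_intCast_iff]
  push_cast
  rw [ht, h]
  simp

theorem le_div_of_dvd_of_isLeast {p g : ℕ} (hp : IsLeast {q : ℕ | q.Prime ∧ q ∣ n} p)
    (hn : 0 < n) (hg : g ∣ n) (hne : g ≠ n) : g ≤ n / p := by
  obtain ⟨c, rfl⟩ := hg
  have hc : c ≠ 1 := by rintro rfl; simp at hne
  have hle : p ≤ c.minFac := hp.2 ⟨Nat.minFac_prime hc, (Nat.minFac_dvd c).mul_left g⟩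
  rw [Nat.le_div_iff_mul_le hp.1.1.pos]
  exact Nat.mul_le_mul_left g
    (hle.trans (Nat.minFac_le (Nat.pos_of_ne_zero (by rintro rfl; simp at hn))))

theorem mem_shortSubgroup_of_card_support_le_odd (hn : 0 < n) {p : ℕ}
    (hp : IsLeast {q : ℕ | q.Prime ∧ q ∣ n} p)
    (hK : ∀ i, Finsupp.single i (n : ℤ) ∈ K) {s : ℕ} (hs : 0 < s) {x : I →₀ ℤ} (hx : x ∈ K)
    (hcard : x.support.card ≤ 2 * s + 1) : x ∈ shortSubgroup K (n * s + n / p) := by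
  have hd : n ≤ n * s + n / p := (Nat.le_mul_of_pos_right n hs).trans (Nat.le_add_right _ _)
  have hn' : (0 : ℤ) < n := by exact_mod_cast hn
  obtain ⟨g, hg, t, u, c, htu, hg'⟩ := exists_coprime_mul_modEq_divisor n (∑ i ∈ x.support, x i)
  suffices h : t • x ∈ shortSubgroup K (n * s + n / p) by
    have hx' : x = u • t • x - (n : ℤ) • c • x := by
      rw [smul_smul, smul_smul, ← sub_smul, mul_comm u, htu, add_sub_cancel_right, one_smul]
    rw [hx']
    exact sub_mem (zsmul_mem h u) (nsmul_mem_shortSubgroup hK hd _)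
  have hy : t • x ∈ K := zsmul_mem hx t
  have hsupp : (t • x).support ⊆ x.support := Finsupp.support_smul
  have hsum := residueSum_add_residueSum_neg_le hn (t • x)
  have hle : (n : ℤ) * (t • x).support.card ≤ n * (2 * s + 1) := by
    exact_mod_cast Nat.mul_le_mul_left n ((Finset.card_le_card hsupp).trans hcard)
  -- A proper divisor of `n` is at most `n / p`; the divisor `n` itself is replaced by `0`.
  obtain ⟨e, he0, hep, heq⟩ : ∃ e : ℤ, 0 ≤ e ∧ e ≤ (n / p : ℕ) ∧
      residueSum n (t • x) ≡ e [ZMOD n] := by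
    have hmod : residueSum n (t • x) ≡ g [ZMOD n] := by
      refine (residueSum_modEq _).trans (Int.ModEq.trans ?_ hg')
      rw [Finset.sum_subset hsupp
        (fun i _ hi => Finsupp.notMem_support_iff.1 hi), Finset.mul_sum]
      rfl
    by_cases hgn : g = n
    · subst hgn
      exact ⟨0, le_rfl, by positivity, hmod.trans (by simp [Int.ModEq])⟩
    · exact ⟨g, by positivity, by exact_mod_cast le_div_of_dvd_of_isLeast hp hn hg hgn, hmod⟩
  obtain ⟨q, hq⟩ := heq.symm.dvd
  rcases le_or_gt q s with h | h
  · refine mem_shortSubgroup_of_residueSum_le hn hK hd hy ?_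
    push_cast at hep ⊢
    nlinarith
  -- Here the residue sum is at least `n * (s + 1)`, leaving at most `n * s` for `-(t • x)`.
  · rw [← neg_mem_iff]
    refine mem_shortSubgroup_of_residueSum_le hn hK hd (neg_mem hy) ?_
    have : (n : ℤ) * (s + 1) ≤ n * q := by gcongr; omega
    push_cast at hep ⊢
    nlinarith

/-- A Helly-type reduction: if every set of `k` coordinates carries a unimodular element of `K`,
then `K` is generated by its elements with at most `k` nonzero entries. -/
theorem le_of_unimodular_of_card_support_le {L : AddSubgroup (I →₀ ℤ)} {k : ℕ}
    (hrel : ∀ T : Finset I, T.card = k → ∃ u ∈ K, u.support ⊆ T ∧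
      ∃ a : I → ℤ, ∑ i ∈ T, a i * u i = 1)
    (hL : ∀ x ∈ K, x.support.card ≤ k → x ∈ L) : K ≤ L := by
  classical
  intro x hx
  induction hN : x.support.card using Nat.strong_induction_on generalizing x with
  | _ N ih =>
    rcases le_or_gt x.support.card k with h | h
    · exact hL x hx h
    obtain ⟨T, hTx, hT⟩ := Finset.exists_subset_card_eq h.le
    obtain ⟨u, hu, huT, a, ha⟩ := hrel T hT
    have huL : u ∈ L := hL u hu ((Finset.card_le_card huT).trans hT.le)
    have key : ∀ j ∈ T, u j • x ∈ L := by
      intro j hj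
      -- The combination cancels coordinate `j` and adds none, because `u` is supported inside the
      -- support of `x`.
      have hlt : (u j • x - x j • u).support.card < N := by
        rw [← hN]
        refine Finset.card_lt_card ⟨fun i hi => ?_, fun hsub => ?_⟩
        · by_contra hxi
          have hui : u i = 0 := Finsupp.notMem_support_iff.1 fun h' => hxi (hTx (huT h'))
          simp [Finsupp.notMem_support_iff.1 hxi, hui] at hi
        · simpa [mul_comm] using hsub (hTx hj)
      have := ih _ hlt (sub_mem (zsmul_mem hx _) (zsmul_mem hu _)) rfl
      simpa using add_mem this (zsmul_mem huL (x j))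
    have hx1 : x = ∑ j ∈ T, a j • u j • x := by
      simp_rw [smul_smul, ← Finset.sum_smul, ha, one_smul]
    rw [hx1]
    exact sum_mem fun j hj => zsmul_mem (key j hj) _

/-- Any `r + 1` vectors in `ℤ^r` are dependent; dividing a relation by the gcd of its coefficients
makes it unimodular. -/
theorem exists_unimodular_relation {r : ℕ} (c : I → Fin r → ℤ) {T : Finset I}
    (hT : T.card = r + 1) :
    ∃ u : I →₀ ℤ, u.support ⊆ T ∧ ∑ i ∈ T, u i • c i = 0 ∧
      ∃ a : I → ℤ, ∑ i ∈ T, a i * u i = 1 := by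
  classical
  have hdep : ¬ LinearIndependent ℤ (fun i : T => c i) := fun h => by
    have := h.fintype_card_le_finrank
    simp [hT] at this
  obtain ⟨f, hf, i₀, hi₀⟩ := Fintype.not_linearIndependent_iff.1 hdep
  obtain ⟨g, hg, hg1⟩ := Finset.extract_gcd f (s := Finset.univ) ⟨i₀, Finset.mem_univ _⟩
  set D := Finset.univ.gcd f
  have hD : D ≠ 0 := by
    intro h
    apply hi₀
    rw [hg i₀ (Finset.mem_univ _), h, zero_mul]
  obtain ⟨a, ha⟩ := Finset.gcd_eq_sum_mul Finset.univ g
  have hgc : ∑ i, g i • c i = 0 := by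
    have h : D • ∑ i, g i • c i = 0 := by
      rw [Finset.smul_sum, ← hf]
      exact Finset.sum_congr rfl fun i hi => by rw [smul_smul, hg i hi]
    exact (smul_eq_zero.1 h).resolve_left hD
  let u : I →₀ ℤ := Finsupp.onFinset T (fun i => if h : i ∈ T then g ⟨i, h⟩ else 0)
    fun i hi => by by_contra h; simp [h] at hi
  have hu : ∀ i : T, u i = g i := fun i => by simp [u]
  refine ⟨u, Finsupp.support_onFinset_subset, ?_, fun i => if h : i ∈ T then a ⟨i, h⟩ else 0, ?_⟩
  · rw [← Finset.sum_coe_sort, ← hgc]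
    exact Finset.sum_congr rfl fun i _ => by rw [hu]
  · rw [← Finset.sum_coe_sort, ← hg1, ha]
    exact Finset.sum_congr rfl fun i _ => by simp [hu, mul_comm]

end

/-! ### Upper bound: from relation lattices to orbits -/

/-- A linear functional on which the group acts through the character `χ`. -/
def IsEigenfunctional {G V : Type*} [Group G] [AddCommGroup V] [Module ℂ V]
    (ρ : Representation ℂ G V) (χ : G →* ℂˣ) (φ : Module.Dual ℂ V) : Prop :=
  ∀ g x, φ (ρ g x) = χ g * φ x

/-- The homomorphism from `ℤ^(I)` sending the standard basis vectors to a family of elements. -/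
noncomputable def zpowProdHom {I M : Type*} [CommGroup M] (f : I → M) :
    Multiplicative (I →₀ ℤ) →* M :=
  AddMonoidHom.toMultiplicativeLeft
    (Finsupp.liftAddHom fun i => zmultiplesHom (Additive M) (Additive.ofMul (f i)))

theorem zpowProdHom_apply {I M : Type*} [CommGroup M] (f : I → M) (x : I →₀ ℤ) :
    zpowProdHom f (Multiplicative.ofAdd x) = ∏ i ∈ x.support, f i ^ x i := by
  simp [zpowProdHom, Finsupp.sum]

theorem zpowProdHom_single {I M : Type*} [CommGroup M] (f : I → M) (i : I) (a : ℤ) :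
    zpowProdHom f (Multiplicative.ofAdd (Finsupp.single i a)) = f i ^ a := by
  simp [zpowProdHom]

section

universe u v

variable {G : Type u} {V : Type v} [CommGroup G] [Finite G] [AddCommGroup V] [Module ℂ V]
  {ρ : Representation ℂ G V}

instance hasEnoughRootsOfUnity_complex_exponent :
    HasEnoughRootsOfUnity ℂ (Monoid.exponent G) :=
  have : NeZero (Monoid.exponent G) := ⟨Monoid.exponent_ne_zero_of_finite⟩
  inferInstance

theorem sum_character_apply_eq_zero [Fintype (G →* ℂˣ)] {g : G} (hg : g ≠ 1) :
    ∑ χ : G →* ℂˣ, (χ g : ℂ) = 0 := by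
  obtain ⟨χ₀, hχ₀⟩ := CommGroup.exists_apply_ne_one_of_hasEnoughRootsOfUnity G ℂ hg
  let f : (G →* ℂˣ) →* ℂ := (Units.coeHom ℂ).comp (MonoidHom.eval g)
  refine sum_hom_units_eq_zero f fun h => hχ₀ ?_
  simpa [f] using DFunLike.congr_fun h χ₀

theorem eq_zero_of_forall_isEigenfunctional {v : V}
    (h : ∀ χ φ, IsEigenfunctional ρ χ φ → φ v = 0) : v = 0 := by
  classical
  have := Fintype.ofFinite G
  have := Fintype.ofFinite (G →* ℂˣ)
  rw [← Module.forall_dual_apply_eq_zero_iff ℂ]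
  intro φ
  -- Unnormalised isotypic projections of `φ`; over all `χ` they sum to `|G| • φ`.
  let ψ (χ : G →* ℂˣ) : Module.Dual ℂ V := ∑ g : G, ((χ g⁻¹ : ℂˣ) : ℂ) • φ ∘ₗ ρ g
  have hψ (χ : G →* ℂˣ) : IsEigenfunctional ρ χ (ψ χ) := by
    intro a x
    simp only [ψ, LinearMap.sum_apply, LinearMap.smul_apply, LinearMap.comp_apply, smul_eq_mul,
      Finset.mul_sum]
    refine Fintype.sum_equiv (Equiv.mulRight a) _ _ fun g => ?_
    simp only [Equiv.coe_mulRight, map_mul, mul_inv_rev, Module.End.mul_apply]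
    push_cast
    rw [← mul_assoc, ← mul_assoc, ← Units.val_mul, ← map_mul, mul_inv_cancel, map_one]
    simp
  have hsum : ∑ χ : G →* ℂˣ, ψ χ v = Fintype.card (G →* ℂˣ) * φ v := by
    simp only [ψ, LinearMap.sum_apply, LinearMap.smul_apply, LinearMap.comp_apply, smul_eq_mul]
    rw [Finset.sum_comm, Finset.sum_eq_single 1]
    · simp
    · intro g _ hg
      rw [← Finset.sum_mul, sum_character_apply_eq_zero (inv_ne_one.2 hg), zero_mul]
    · simp
  rw [Finset.sum_eq_zero fun χ _ => h χ _ (hψ χ)] at hsum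
  exact (mul_eq_zero.1 hsum.symm).resolve_left (by simp)

/-- A homomorphism that factors through a family of characters is evaluation at a group element. -/
theorem exists_forall_apply_eq {A : Type*} [Group A] (L : A →* (G →* ℂˣ)) (Φ : A →* ℂˣ)
    (h : L.ker ≤ Φ.ker) : ∃ g : G, ∀ a, L a g = Φ a := by
  have hker : L.rangeRestrict.ker ≤ Φ.ker := by rwa [MonoidHom.ker_rangeRestrict]
  let ψ := L.rangeRestrict.liftOfSurjective L.rangeRestrict_surjective ⟨Φ, hker⟩
  obtain ⟨η, hη⟩ := MonoidHom.domRestrict_surjective ℂ L.range ψ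
  refine ⟨CommGroup.monoidHomMonoidHomEquiv G ℂ η, fun a => ?_⟩
  rw [CommGroup.apply_monoidHomMonoidHomEquiv]
  have h1 : η (L a) = ψ (L.rangeRestrict a) := by rw [← hη]; rfl
  rw [h1]
  exact MonoidHom.liftOfRightInverse_comp_apply _ _ _ ⟨Φ, hker⟩ a

theorem isHomogeneousPolynomialFunction_prod_pow {J : Type*} (s : Finset J)
    (φ : J → Module.Dual ℂ V) (m : J → ℕ) :
    IsHomogeneousPolynomialFunction (∑ i ∈ s, m i) (fun x : V => ∏ i ∈ s, φ i x ^ m i) :=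
  ⟨∏ i ∈ s, MvPolynomial.X (φ i) ^ m i,
    MvPolynomial.IsHomogeneous.prod _ _ _ fun _ _ => MvPolynomial.isHomogeneous_X_pow _ _,
    fun v => by simp [map_prod]⟩

theorem separatesOrbitsInDegree_of_shortSubgroup {n r d : ℕ} (hn : 0 < n) (hd : n ≤ d)
    (hG : ∀ g : G, g ^ n = 1) (e : Multiplicative (Fin r → ℤ) →* G)
    (he : Function.Surjective e)
    (hshort : ∀ (J : Type (max u v)) (K : AddSubgroup (J →₀ ℤ)),
      (∀ i, Finsupp.single i (n : ℤ) ∈ K) →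
        ∀ x ∈ K, x.support.card ≤ r + 1 → x ∈ shortSubgroup K d)
    (ρ : Representation ℂ G V) : SeparatesOrbitsInDegree ρ d := by
  intro v w hvw
  by_contra! hinv
  have hχn (χ : G →* ℂˣ) : χ ^ n = 1 := by
    ext g; rw [MonoidHom.pow_apply, ← map_pow, hG, map_one, MonoidHom.one_apply]
  have hprod {J : Type (max u v)} (s : Finset J) (φ : J → Module.Dual ℂ V) (χ : J → G →* ℂˣ)
      (m : J → ℕ) (hφ : ∀ i, IsEigenfunctional ρ (χ i) (φ i)) (hχ : ∏ i ∈ s, χ i ^ m i = 1)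
      (hm : ∑ i ∈ s, m i ≤ d) : ∏ i ∈ s, φ i v ^ m i = ∏ i ∈ s, φ i w ^ m i := by
    refine hinv (fun x : V => ∏ i ∈ s, φ i x ^ m i)
      ⟨_, hm, isHomogeneousPolynomialFunction_prod_pow s φ m⟩ fun g x => ?_
    have h1 : ∏ i ∈ s, ((χ i g : ℂˣ) : ℂ) ^ m i = 1 := by
      have := congrArg (fun u : ℂˣ => (u : ℂ)) (DFunLike.congr_fun hχ g)
      simpa [MonoidHom.finsetProd_apply] using this
    simp only [hφ _ g x, mul_pow, Finset.prod_mul_distrib, h1, one_mul]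
  have hzero (χ φ) (hφ : IsEigenfunctional ρ χ φ) : φ v = 0 ↔ φ w = 0 := by
    have := hprod {PUnit.unit} (fun _ => φ) (fun _ => χ) (fun _ => n) (fun _ => hφ)
      (by simpa using hχn χ) (by simpa using hd)
    simp only [Finset.prod_singleton] at this
    rw [← pow_eq_zero_iff hn.ne', this, pow_eq_zero_iff hn.ne']
  -- The dual group is isomorphic to `G`, hence also a quotient of `ℤ^r`; relations among integer
  -- lifts give relations among characters.
  obtain ⟨e', he'⟩ : ∃ e' : Multiplicative (Fin r → ℤ) →* (G →* ℂˣ), Function.Surjective e' := by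
    obtain ⟨E⟩ := CommGroup.monoidHom_mulEquiv_of_hasEnoughRootsOfUnity G ℂ
    exact ⟨E.symm.toMonoidHom.comp e, E.symm.surjective.comp he⟩
  choose c' hc' using he'
  let c (χ : G →* ℂˣ) : Fin r → ℤ := Multiplicative.toAdd (c' χ)
  have hc (χ : G →* ℂˣ) : e' (Multiplicative.ofAdd (c χ)) = χ := hc' χ
  let J := {q : Module.Dual ℂ V × (G →* ℂˣ) // IsEigenfunctional ρ q.2 q.1 ∧ q.1 v ≠ 0}
  let z (i : J) : ℂˣ := Units.mk0 (i.1.1 w / i.1.1 v)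
    (div_ne_zero (fun h => i.2.2 ((hzero _ _ i.2.1).2 h)) i.2.2)
  let L := zpowProdHom fun i : J => i.1.2
  let Φ := zpowProdHom z
  let K : AddSubgroup (J →₀ ℤ) := Subgroup.toAddSubgroup' L.ker
  let N : AddSubgroup (J →₀ ℤ) := Subgroup.toAddSubgroup' Φ.ker
  have hKmem (x : J →₀ ℤ) : x ∈ K ↔ L (Multiplicative.ofAdd x) = 1 := Iff.rfl
  have hNmem (x : J →₀ ℤ) : x ∈ N ↔ Φ (Multiplicative.ofAdd x) = 1 := Iff.rfl
  have hK (i : J) : Finsupp.single i (n : ℤ) ∈ K := by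
    rw [hKmem, zpowProdHom_single, zpow_natCast, hχn]
  have hSN : shortSubgroup K d ≤ N := by
    refine (AddSubgroup.closure_le N).2 ?_
    rintro x ⟨hx, hx0, hxd⟩
    obtain ⟨m, rfl⟩ : ∃ m : J →₀ ℕ, x = m.mapRange (fun k : ℕ => (k : ℤ)) rfl :=
      ⟨x.mapRange Int.toNat rfl, by ext i; simp [hx0 i]⟩
    have hsupp : (m.mapRange (fun k : ℕ => (k : ℤ)) rfl).support = m.support :=
      Finsupp.support_mapRange_of_injective _ _ Nat.cast_injective
    rw [hKmem, zpowProdHom_apply, hsupp] at hx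
    rw [hsupp] at hxd
    simp only [Finsupp.mapRange_apply, zpow_natCast] at hx hxd
    have hvw' := hprod m.support (fun i : J => i.1.1) (fun i => i.1.2) m (fun i => i.2.1) hx
      (by exact_mod_cast hxd)
    have hne : ∏ i ∈ m.support, i.1.1 v ^ m i ≠ 0 :=
      Finset.prod_ne_zero_iff.2 fun i _ => pow_ne_zero _ i.2.2
    change _ ∈ N
    rw [hNmem, zpowProdHom_apply, hsupp]
    ext
    simp only [Finsupp.mapRange_apply, zpow_natCast, Units.coe_prod, Units.val_pow_eq_pow_val,
      Units.val_mk0, div_pow, Finset.prod_div_distrib, Units.val_one, z]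
    rw [← hvw', div_self hne]
  have hKN : K ≤ N := by
    refine le_trans (le_of_unimodular_of_card_support_le (k := r + 1) (fun T hT => ?_)
      (hshort J K hK)) hSN
    obtain ⟨u, huT, hu0, hu1⟩ := exists_unimodular_relation (fun i : J => c i.1.2) hT
    refine ⟨u, ?_, huT, hu1⟩
    rw [hKmem, zpowProdHom_apply, Finset.prod_subset huT fun i _ hi => by
      rw [Finsupp.notMem_support_iff.1 hi, zpow_zero]]
    have := congrArg (fun y => e' (Multiplicative.ofAdd y)) hu0
    simpa only [ofAdd_sum, ofAdd_zsmul, map_prod, map_zpow, hc, ofAdd_zero, map_one] using this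
  obtain ⟨g, hg⟩ := exists_forall_apply_eq L Φ hKN
  refine hvw g (sub_eq_zero.1 (eq_zero_of_forall_isEigenfunctional (ρ := ρ) fun χ φ hφ => ?_))
  rw [map_sub, hφ, sub_eq_zero]
  by_cases h0 : φ v = 0
  · rw [h0, (hzero χ φ hφ).1 h0, mul_zero]
  · have := hg (Multiplicative.ofAdd (Finsupp.single ⟨(φ, χ), hφ, h0⟩ 1))
    rw [zpowProdHom_single, zpowProdHom_single, zpow_one, zpow_one] at this
    rw [this]
    simp [z, h0]

end

theorem separatesOrbitsInDegree_pi_zmod {n r d : ℕ} (hn : 0 < n) (hd : n ≤ d)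
    (hshort : ∀ (J : Type) (K : AddSubgroup (J →₀ ℤ)),
      (∀ i, Finsupp.single i (n : ℤ) ∈ K) →
        ∀ x ∈ K, x.support.card ≤ r + 1 → x ∈ shortSubgroup K d)
    {V : Type} [AddCommGroup V] [Module ℂ V]
    (ρ : Representation ℂ (Multiplicative (Fin r → ZMod n)) V) :
    SeparatesOrbitsInDegree ρ d := by
  have : NeZero n := ⟨hn.ne'⟩
  refine separatesOrbitsInDegree_of_shortSubgroup hn hd (fun g => ?_)
    (AddMonoidHom.toMultiplicative
      ((Int.castAddHom (ZMod n)).compLeft (Fin r))) (fun g => ?_) hshort ρ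
  · refine Multiplicative.toAdd.injective (funext fun i => ?_)
    simp
  · choose f hf using fun i => ZMod.intCast_surjective (Multiplicative.toAdd g i)
    exact ⟨Multiplicative.ofAdd f, Multiplicative.toAdd.injective (funext hf)⟩

theorem sepNoetherNumber_pi_zmod_le {n r d : ℕ} (hn : 0 < n) (hd : n ≤ d)
    (hshort : ∀ (J : Type) (K : AddSubgroup (J →₀ ℤ)),
      (∀ i, Finsupp.single i (n : ℤ) ∈ K) →
        ∀ x ∈ K, x.support.card ≤ r + 1 → x ∈ shortSubgroup K d) :
    sepNoetherNumber (Multiplicative (Fin r → ZMod n)) ≤ d :=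
  iSup_le fun _ => iSup_le fun _ => iSup_le fun _ => iSup_le fun _ => iSup_le fun ρ =>
    iInf₂_le d ⟨hn.trans_le hd, separatesOrbitsInDegree_pi_zmod hn hd hshort ρ⟩

/-! ### Lower bound: an extremal diagonal representation -/

/-- The diagonal representation given by a family of characters. -/
noncomputable def diagonalRepresentation {G J : Type*} [Group G] (χ : J → G →* ℂ) :
    Representation ℂ G (J → ℂ) where
  toFun g := LinearMap.pi fun j => χ j g • LinearMap.proj j
  map_one' := by ext; simp
  map_mul' g h := by
    refine LinearMap.ext fun x => funext fun j => ?_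
    simp [mul_assoc]

@[simp]
theorem diagonalRepresentation_apply {G J : Type*} [Group G] (χ : J → G →* ℂ) (g : G)
    (x : J → ℂ) (j : J) : diagonalRepresentation χ g x j = χ j g * x j := by
  simp [diagonalRepresentation]

theorem IsHomogeneousPolynomialFunction.exists_coordinates {J : Type*} [Fintype J] {k : ℕ}
    {f : (J → ℂ) → ℂ} (hf : IsHomogeneousPolynomialFunction k f) :
    ∃ Q : MvPolynomial J ℂ, Q.IsHomogeneous k ∧ ∀ x, f x = MvPolynomial.eval x Q := by
  classical
  obtain ⟨P, hP, hfP⟩ := hf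
  refine ⟨MvPolynomial.bind₁ (fun φ : Module.Dual ℂ (J → ℂ) =>
    ∑ j, MvPolynomial.C (φ (Pi.single j 1)) * MvPolynomial.X j) P, ?_, fun x => ?_⟩
  · rw [← one_mul k]
    exact hP.aeval (n := 1) _ fun φ => MvPolynomial.IsHomogeneous.sum _ _ _ fun j _ =>
      MvPolynomial.isHomogeneous_C_mul_X _ j
  · rw [hfP, MvPolynomial.eval, MvPolynomial.eval, MvPolynomial.eval₂Hom_bind₁]
    congr 2
    funext φ
    conv_lhs => rw [pi_eq_sum_univ' x]
    simp [mul_comm]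

/-- Averaging over `G` kills every non-invariant monomial, so invariant monomials alone decide
separation. -/
theorem eq_of_forall_invariant_monomial {G J : Type*} [Group G] [Finite G] [Fintype J]
    (χ : J → G →* ℂ) {k : ℕ} {f : (J → ℂ) → ℂ} (hf : IsHomogeneousPolynomialFunction k f)
    (hinv : ∀ g x, f (diagonalRepresentation χ g x) = f x) {v w : J → ℂ}
    (h : ∀ m : J → ℕ, ∑ j, m j = k → (∀ g, ∏ j, χ j g ^ m j = 1) →
      ∏ j, v j ^ m j = ∏ j, w j ^ m j) : f v = f w := by
  classical
  have := Fintype.ofFinite G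
  obtain ⟨Q, hQ, hfQ⟩ := hf.exists_coordinates
  have hsum (x : J → ℂ) : Fintype.card G * f x =
      ∑ m ∈ Q.support, Q.coeff m * ((∑ g, ∏ j, χ j g ^ m j) * ∏ j, x j ^ m j) := by
    calc Fintype.card G * f x = ∑ g : G, f (diagonalRepresentation χ g x) := by simp [hinv]
      _ = _ := by
        simp only [hfQ, MvPolynomial.eval_eq', diagonalRepresentation_apply, mul_pow,
          Finset.prod_mul_distrib]
        rw [Finset.sum_comm]
        simp only [Finset.sum_mul, Finset.mul_sum]
  have hcard : (Fintype.card G : ℂ) ≠ 0 := by simp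
  apply mul_left_cancel₀ hcard
  rw [hsum, hsum]
  refine Finset.sum_congr rfl fun m hm => ?_
  congr 1
  let θ : G →* ℂ :=
    { toFun := fun g => ∏ j, χ j g ^ m j
      map_one' := by simp
      map_mul' := fun a b => by simp [mul_pow, Finset.prod_mul_distrib] }
  by_cases hθ : θ = 1
  · rw [h m ?_ fun g => DFunLike.congr_fun hθ g]
    rw [← Finsupp.degree_eq_sum]
    by_contra hne
    exact MvPolynomial.mem_support_iff.1 hm (hQ.coeff_eq_zero hne)
  · have : ∑ g, ∏ j, χ j g ^ m j = 0 := sum_hom_units_eq_zero θ hθ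
    rw [this, zero_mul, zero_mul]

/-- The test points are `(ω, 1, ..., 1)` and `(1, ..., 1)` with `ω` a primitive `p`-th root of
unity: a monomial separates them exactly when `p ∤ m 0`. The coordinate characters force `g = 0`, so
the orbits differ. -/
theorem le_sepNoetherNumber_pi_zmod {n r p D : ℕ} (hn : 0 < n) (hp : p.Prime)
    (b : Fin r → ZMod n)
    (h : ∀ m : Fin (r + 1) → ℕ, (∀ i : Fin r, (m i.succ : ZMod n) = b i * m 0) →
      ∑ j, m j < D → p ∣ m 0) :
    (D : ℕ∞) ≤ sepNoetherNumber (Multiplicative (Fin r → ZMod n)) := by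
  have : NeZero n := ⟨hn.ne'⟩
  let l : Fin (r + 1) → (Fin r → ZMod n) →+ ZMod n :=
    Fin.cons (-∑ i, (AddMonoidHom.mulLeft (b i)).comp (Pi.evalAddMonoidHom _ i))
      fun i => Pi.evalAddMonoidHom _ i
  let χ (j : Fin (r + 1)) : Multiplicative (Fin r → ZMod n) →* ℂ :=
    ((ZMod.stdAddChar (N := n)).compAddMonoidHom (l j)).toMonoidHom
  have hχ (j g) : χ j (Multiplicative.ofAdd g) = ZMod.stdAddChar (l j g) := rfl
  refine le_trans ?_ (le_iSup_of_le (Fin (r + 1) → ℂ) <| le_iSup_of_le inferInstance <|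
    le_iSup_of_le inferInstance <| le_iSup_of_le inferInstance <|
    le_iSup_of_le (diagonalRepresentation χ) le_rfl)
  refine le_iInf₂ fun d hd => ?_
  by_contra! hlt
  have hdD : d < D := by exact_mod_cast hlt
  obtain ⟨ω, hω⟩ : ∃ ω : ℂ, IsPrimitiveRoot ω p := ⟨_, Complex.isPrimitiveRoot_exp p hp.ne_zero⟩
  have hinj := ZMod.injective_stdAddChar (N := n)
  obtain ⟨f, ⟨k, hk, hf⟩, hinv, hne⟩ := hd.2 (Fin.cons ω fun _ => 1) (fun _ => 1) fun g hg => by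
    have hg0 : ∀ i, Multiplicative.toAdd g i = 0 := fun i => by
      have := congrFun hg i.succ
      rw [diagonalRepresentation_apply, ← ofAdd_toAdd g, hχ] at this
      apply hinj
      simpa [l] using this
    have := congrFun hg 0
    rw [diagonalRepresentation_apply, ← ofAdd_toAdd g, hχ] at this
    refine hω.ne_one hp.one_lt ?_
    simpa [l, hg0] using this
  refine hne (eq_of_forall_invariant_monomial χ hf hinv fun m hm hχm => ?_)
  have hp0 : p ∣ m 0 := by
    refine h m (fun i => ?_) (hm ▸ hk.trans_lt hdD)
    -- Invariance under the `i`-th generator reads `m i.succ - b i * m 0 = 0`.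
    have := hχm (Multiplicative.ofAdd (Pi.single i 1))
    simp only [hχ, ← AddChar.map_nsmul_eq_pow] at this
    rw [Fin.prod_univ_succ, Finset.prod_eq_single i ?_ (by simp), ← AddChar.map_add_eq_mul,
      ← AddChar.map_zero_eq_one (ZMod.stdAddChar (N := n))] at this
    · have := hinj this
      simp [l, Pi.single_apply] at this
      linear_combination this
    · intro j _ hj
      simp [l, hj]
  simp [Fin.prod_univ_succ, (hω.pow_eq_one_iff_dvd _).2 hp0]

/-- Each of the `s` consecutive pairs has opposite nonzero residues, so its sum is a positive
multiple of `n`. -/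
theorem mul_le_sum_range_of_alternating {n : ℕ} (h : ℕ → ℕ) (h0 : ¬ n ∣ h 0) (s : ℕ)
    (hh : ∀ j < 2 * s, (h j : ZMod n) = (-1) ^ j * h 0) :
    n * s ≤ ∑ j ∈ Finset.range (2 * s), h j := by
  induction s with
  | zero => simp
  | succ s ih =>
    have h1 := hh (2 * s) (by omega)
    have h2 := hh (2 * s + 1) (by omega)
    rw [pow_succ] at h2
    rw [pow_mul, neg_one_sq, one_pow, one_mul] at h1 h2
    have hdvd : n ∣ h (2 * s) + h (2 * s + 1) := by
      rw [← ZMod.natCast_eq_zero_iff]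
      push_cast
      rw [h1, h2]
      ring
    have hpos : 0 < h (2 * s) + h (2 * s + 1) := by
      by_contra! hle
      have hz : h (2 * s) = 0 := by omega
      rw [hz, Nat.cast_zero] at h1
      exact h0 ((ZMod.natCast_eq_zero_iff _ _).1 h1.symm)
    have := Nat.le_of_dvd hpos hdvd
    have := ih fun j hj => hh j (by omega)
    rw [mul_add, mul_add, mul_one, mul_one, Finset.sum_range_succ, Finset.sum_range_succ]
    omega

theorem le_of_natCast_eq_div_mul {n p a t : ℕ} (hn : 0 < n) (hpn : p ∣ n) (ht : ¬ p ∣ t)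
    (ha : (a : ZMod n) = (n / p : ℕ) * t) : n / p ≤ a := by
  obtain ⟨c, rfl⟩ := hpn
  have hp : 0 < p := Nat.pos_of_mul_pos_right hn
  have hc : 0 < c := Nat.pos_of_mul_pos_left hn
  rw [Nat.mul_div_cancel_left c hp] at ha ⊢
  rw [← Nat.cast_mul, ZMod.natCast_eq_natCast_iff] at ha
  have hca : c ∣ a := (ha.dvd_iff (Dvd.intro_left p rfl)).2 (Dvd.intro t rfl)
  refine Nat.le_of_dvd (Nat.pos_of_ne_zero ?_) hca
  rintro rfl
  have h := (Nat.modEq_zero_iff_dvd.1 ha.symm)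
  rw [mul_comm p] at h
  exact ht (Nat.dvd_of_mul_dvd_mul_left hc h)

/-- The coefficients of the extra weight in the representation attaining the separating Noether
number. -/
def extremalCoeff (n p s r : ℕ) (i : Fin r) : ZMod n :=
  -- The shift by one accounts for the extra weight at index `0`. For `r = 2 * s - 1` the second
  -- branch is never reached; for `r = 2 * s` only the last index reaches it.
  if (i : ℕ) + 1 < 2 * s then (-1) ^ ((i : ℕ) + 1) else (n / p : ℕ)

theorem dvd_of_extremal_relation {n p s r : ℕ} (hn : 0 < n) (hpn : p ∣ n) (hs : 0 < s)
    (m : Fin (r + 1) → ℕ) (hm : ∀ i : Fin r, (m i.succ : ZMod n) = extremalCoeff n p s r i * m 0)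
    (hr : 2 * s ≤ r + 1) (e : ℕ) (he : e = 0 ∨ 2 * s = r ∧ e = n / p)
    (hsum : ∑ j, m j < n * s + e) : p ∣ m 0 := by
  by_contra hp0
  let h (j : ℕ) : ℕ := if hj : j < r + 1 then m ⟨j, hj⟩ else 0
  have hh0 : h 0 = m 0 := by simp [h]
  have hsucc (j : ℕ) (hj : j < r) : (h (j + 1) : ZMod n) = extremalCoeff n p s r ⟨j, hj⟩ * m 0 := by
    rw [← hm ⟨j, hj⟩]
    simp [h, hj]
  have hsum' : ∑ j, m j = ∑ j ∈ Finset.range (r + 1), h j := by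
    rw [← Fin.sum_univ_eq_sum_range]
    exact Finset.sum_congr rfl fun j _ => by simp only [h, dif_pos j.isLt]
  have halt := mul_le_sum_range_of_alternating h (fun hd => hp0 (hh0 ▸ hpn.trans hd)) s
    fun j hj => by
      rcases j with _ | j
      · simp
      · rw [hsucc j (by omega), hh0, extremalCoeff, if_pos hj]
  rw [hsum'] at hsum
  rcases he with rfl | ⟨rfl, rfl⟩
  · have := Finset.sum_le_sum_of_subset (f := h) (Finset.range_subset_range.2 hr)
    omega
  · have hlast : n / p ≤ h (2 * s) := by
      refine le_of_natCast_eq_div_mul hn hpn hp0 ?_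
      have := hsucc (2 * s - 1) (by omega)
      rwa [extremalCoeff, if_neg (by simp; omega), Nat.sub_add_cancel (by omega)] at this
    rw [Finset.sum_range_succ] at hsum
    omega

theorem theorem1p1 (n r : ℕ) (hn : 2 ≤ n) (hr : 1 ≤ r) (p : ℕ)
    (hp : IsLeast {q : ℕ | q.Prime ∧ q ∣ n} p) :
    (∀ s : ℕ, r + 1 = 2 * s →
      sepNoetherNumber (Multiplicative (Fin r → ZMod n)) = ((n * s : ℕ) : ℕ∞)) ∧
    (∀ s : ℕ, r = 2 * s →
      sepNoetherNumber (Multiplicative (Fin r → ZMod n)) = ((n * s + n / p : ℕ) : ℕ∞)) := by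
  have hn0 : 0 < n := by omega
  refine ⟨fun s hs => le_antisymm ?_ ?_, fun s hs => le_antisymm ?_ ?_⟩
  · exact sepNoetherNumber_pi_zmod_le hn0 (Nat.le_mul_of_pos_right n (by omega))
      fun J K hK x hx hcard =>
        mem_shortSubgroup_of_card_support_le_even hn0 hK (by omega) hx (by omega)
  · exact le_sepNoetherNumber_pi_zmod hn0 hp.1.1 (extremalCoeff n p s r) fun m hm hsum =>
      dvd_of_extremal_relation hn0 hp.1.2 (by omega) m hm hs.ge 0 (.inl rfl) hsum
  · exact sepNoetherNumber_pi_zmod_le hn0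
      ((Nat.le_mul_of_pos_right n (by omega)).trans (Nat.le_add_right _ _))
      fun J K hK x hx hcard =>
        mem_shortSubgroup_of_card_support_le_odd hn0 hp hK (by omega) hx (by omega)
  · exact le_sepNoetherNumber_pi_zmod hn0 hp.1.1 (extremalCoeff n p s r) fun m hm hsum =>
      dvd_of_extremal_relation hn0 hp.1.2 (by omega) m hm (by omega) (n / p)
        (.inr ⟨hs.symm, rfl⟩) hsum
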